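/- Let $R=\{\pm\epsilon,\pm2\epsilon\}$ be the root system of type $BC_1$, with weight lattice $P=\mathbb{Z}\epsilon$ and Weyl group $\mathbb{Z}_2=\{1,s\}$, $s\epsilon=-\epsilon$. For a multiplicity $k=(k_1,k_2)$ with $k_1,k_2\ge 0$ ($k_1$ the value on $\pm\epsilon$, $k_2$ on $\pm2\epsilon$) put $\rho(k)=\tfrac12(k_1+2k_2)$ and define on $\mathbb{C}[z^{\pm1}]$ the inner product $$(f,g)_k=\frac{1}{2\pi}\int_{S^1}\overline{f(z)}\,g(z)\,\delta_k(z)\,\frac{dz}{iz},\qquad \delta_k(z)=\bigl(2-z-z^{-1}\bigr)^{k_1}\bigl(2-z^2-z^{-2}\bigr)^{k_2},$$ with $\|f\|_k^2=(f,f)_k$. Let $E(n,k)$, $n\in\mathbb{Z}$, be the non-symmetric Jacobi polynomials: the orthogonal basis of $\mathbb{C}[z^{\pm1}]$ obtained by the Gram–Schmidt process for $(\cdot,\cdot)_k$ from the ordered basis $1,z,z^{-1},z^2,z^{-2},\dots$, where $E(n,k)$ has leading term $z^n$ with coefficient $1$. Write $E(\lambda,k)=E(n,k)$ for $\lambda=n\epsilon\in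 P$. For $\lambda=n\epsilon\in P$ let $\lambda^*=|n|\epsilon$; let $w^\lambda$ be the shortest element of $\mathbb{Z}_2$ with $\lambda=w^\lambda\lambda^*$ ($w^\lambda=1$ if $n\ge0$, $w^\lambda=s$ if $n<0$), and let $w_{\lambda}$ be the longest element of the stabilizer of $\lambda$ ($w_\lambda=s$ if $n=0$, $w_\lambda=1$ otherwise). For $t\in\mathbb{R}$ the generalized Harish-Chandra $c$-functions are $$\widetilde c_1(t\epsilon,k)=\frac{\Gamma(t)\Gamma(t+\frac12)}{2^{k_1}\Gamma(t+\frac12k_1+\frac12)\Gamma(t+\frac12k_1+k_2)},\qquad \widetilde c_s(t\epsilon,k)=\frac{\Gamma(t+\frac12)\Gamma(t+1)}{2^{k_1}\Gamma(t+\frac12k_1+\frac12)\Gamma(t+\frac12k_1+k_2+1)},$$ $$c^*_1(t\epsilon,k)=\frac{\Gamma(-t-\frac12k_1+\frac12)\Gamma(-t-\frac12k_1-k_2)}{2^{k_1}\Gamma(-t)\Gamma(-t+\frac12)},\qquad c^*_s(t\epsilon,k)=\frac{\Gamma(-t-\frac12k_1+\frac12)\Gamma(-t-\frac12k_1-k_2+1)}{2^{k_1}\Gamma(-t+\frac12)\Gamma(-t+1)}.$$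 Theorem. Let $k=(k_1,k_2)\in2\mathbb{Z}\times\mathbb{Z}$ with $k_1\ge1$ and $k_2\ge1$. Then for every $\lambda\in P$, with $w=w^\lambda w_{\lambda^*}$, $$\|E(\lambda,k)\|_k^2=\frac{c^*_{w}\bigl(-(\lambda^*+\rho(k)\epsilon),k\bigr)}{\widetilde c_{w}\bigl(\lambda^*+\rho(k)\epsilon,k\bigr)}.$$ -/

import Mathlib

noncomputable section

namespace NonsymJacobi

/-- A root multiplicity of type `BC₁` on the root system `{±ε, ±2ε}`: `k1` is its value on `±ε`
and `k2` its value on `±2ε`. -/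
structure Multiplicity where
  k1 : ℝ
  k2 : ℝ

/-- `ρ(k) = (k₁ + 2 k₂) / 2`, so that the Weyl vector is `ρ(k) ε`. -/
def rho (k : Multiplicity) : ℝ := (k.k1 + 2 * k.k2) / 2

/-- The weight `δ_k(z) = (2 - z - z⁻¹)^{k₁} (2 - z² - z⁻²)^{k₂}`. For `|z| = 1` both bases are
real and nonnegative: they equal `|1 - z|²` and `|1 - z²|²`. -/
def weight (k : Multiplicity) (z : ℂ) : ℝ :=
  (2 - (z + z⁻¹)).re ^ k.k1 * (2 - (z ^ 2 + (z ^ 2)⁻¹)).re ^ k.k2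

/-- The value `f(z) = ∑ aₙ zⁿ` of a Laurent polynomial at a (nonzero) complex number. -/
def evalAt (f : LaurentPolynomial ℂ) (z : ℂ) : ℂ := f.coeff.sum fun n a => a * z ^ n

/-- The sesquilinear pairing, conjugate linear in the first argument,
`(f, g)_k = (2πi)⁻¹ ∮_{|z| = 1} conj (f z) * g z * δ_k z * dz / z`. -/
def pairing (k : Multiplicity) (f g : LaurentPolynomial ℂ) : ℂ :=
  (2 * (Real.pi : ℂ) * Complex.I)⁻¹ *
    ∮ z in C(0, 1), (starRingEnd ℂ (evalAt f z) * evalAt g z * (weight k z : ℂ)) / z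

/-- `‖f‖_k² = (f, f)_k`, as a complex number. -/
def normSq (k : Multiplicity) (f : LaurentPolynomial ℂ) : ℂ := pairing k f f

/-- The exponent of the `j`-th monomial in the ordered basis `1, z, z⁻¹, z², z⁻², …`. -/
def exponent (j : ℕ) : ℤ := if j % 2 = 0 then -((j / 2 : ℕ) : ℤ) else (((j + 1) / 2 : ℕ) : ℤ)

/-- The position of `zⁿ` in the ordered basis `1, z, z⁻¹, z², z⁻², …`. -/
def position (n : ℤ) : ℕ := if 0 < n then (2 * n - 1).toNat else (-2 * n).toNat

theorem exponent_position (n : ℤ) : exponent (position n) = n := by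
  unfold exponent position
  split_ifs <;> omega

theorem position_exponent (j : ℕ) : position (exponent j) = j := by
  unfold exponent position
  split_ifs <;> omega

/-- The Gram–Schmidt process (without normalization of the vectors) for `(·, ·)_k`, applied to
the ordered basis `1, z, z⁻¹, z², z⁻², …`. -/
def gramSchmidtSeq (k : Multiplicity) (j : ℕ) : LaurentPolynomial ℂ :=
  LaurentPolynomial.T (exponent j) -
    ∑ i : Fin j,
      (pairing k (gramSchmidtSeq k i) (LaurentPolynomial.T (exponent j)) /
        pairing k (gramSchmidtSeq k i) (gramSchmidtSeq k i)) • gramSchmidtSeq k i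
termination_by j
decreasing_by all_goals exact i.2

/-- The non-symmetric Jacobi polynomial `E(λ, k) = E(n, k)` for the weight `λ = n ε`: the
Gram–Schmidt polynomial with leading monomial `zⁿ`. -/
def E (n : ℤ) (k : Multiplicity) : LaurentPolynomial ℂ := gramSchmidtSeq k (position n)

/-! The weight lattice `P = ℤ ε` is identified with `ℤ`, and the Weyl group `{1, s}` with the
group of units `{1, -1}` of `ℤ`, acting on `ℤ` by multiplication, so `s = -1`. -/

/-- `λ*`, the dominant weight in the Weyl group orbit of `λ`. -/
def dominant (n : ℤ) : ℤ := |n|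

/-- `w^λ`, the shortest Weyl group element with `λ = w^λ λ*`. -/
def shortest (n : ℤ) : ℤˣ := if 0 ≤ n then 1 else -1

/-- `w_λ`, the longest element of the stabilizer of `λ`. -/
def longestStab (n : ℤ) : ℤˣ := if n = 0 then -1 else 1

theorem shortest_smul_dominant (n : ℤ) : (shortest n : ℤ) * dominant n = n := by
  unfold shortest dominant
  split_ifs with h
  · simp [abs_of_nonneg h]
  · simp [abs_of_neg (not_le.mp h)]

/-- The generalized Harish-Chandra function `c̃_w(λ, k)`, where `t = λ(e₁)`, i.e. `λ = t ε`. -/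
def cTilde (w : ℤˣ) (t : ℝ) (k : Multiplicity) : ℝ :=
  if w = 1 then
    Real.Gamma t * Real.Gamma (t + 1 / 2) /
      ((2 : ℝ) ^ k.k1 * Real.Gamma (t + k.k1 / 2 + 1 / 2) * Real.Gamma (t + k.k1 / 2 + k.k2))
  else
    Real.Gamma (t + 1 / 2) * Real.Gamma (t + 1) /
      ((2 : ℝ) ^ k.k1 * Real.Gamma (t + k.k1 / 2 + 1 / 2) *
        Real.Gamma (t + k.k1 / 2 + k.k2 + 1))

/-- The generalized Harish-Chandra function `c*_w(λ, k)`, where `t = λ(e₁)`, i.e. `λ = t ε`. -/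
def cStar (w : ℤˣ) (t : ℝ) (k : Multiplicity) : ℝ :=
  if w = 1 then
    Real.Gamma (-t - k.k1 / 2 + 1 / 2) * Real.Gamma (-t - k.k1 / 2 - k.k2) /
      ((2 : ℝ) ^ k.k1 * Real.Gamma (-t) * Real.Gamma (-t + 1 / 2))
  else
    Real.Gamma (-t - k.k1 / 2 + 1 / 2) * Real.Gamma (-t - k.k1 / 2 - k.k2 + 1) /
      ((2 : ℝ) ^ k.k1 * Real.Gamma (-t + 1 / 2) * Real.Gamma (-t + 1))

end NonsymJacobi

end

/-! ### Moments of the weight and the Pearson recurrence -/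

noncomputable section

namespace NonsymJacobi

/-! The ordering `1, z, z⁻¹, z², …` turns Gram–Schmidt on Laurent polynomials into Szegő's theory of
orthogonal polynomials `Φ_N` on the unit circle: up to a power of `z`, the `j`-th vector is `Φ_j` or
its reversal. Its squared norm is therefore `μ₀ ∏_{N<j} (1 - α_N²)`, with `μ₀` the total mass and
`α_N` the Verblunsky coefficients. For `k = (a, b)` integral these are `a / (N+1+a+2b)` for even `N`
and `(a+2b) / (N+1+a+2b)` for odd `N`. The factors of `1 - α_N²` are quotients of linear functions
of `N`, so the product is a quotient of Gamma values, namely that of the `c`-functions.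

The values `α_N` are postulated and then verified. `Φ_N` enters only through its moments
`szegoMoment`. The Pearson recurrence `moment_pearson` propagates along the Szegő recursion to
`szegoMoment_structure`, which forces orthogonality (`szegoMoment_eq_zero`). Norms follow from
`szegoMoment_diag_succ` and `moment_zero_eq`, and `gramSchmidtSeq_eq_szegoJacobi` transfers them to
`E`. -/

/-- The moments of `δ_k` for `k = (a, b)`, as a sequence indexed by `ℤ`. -/
def moment (a : ℕ) : ℕ → ℤ → ℝ
  | 0 => a.rec (fun m => if m = 0 then 1 else 0)
      fun _ μ m => 2 * μ m - μ (m + 1) - μ (m - 1)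
  | b + 1 => fun m => 2 * moment a b m - moment a b (m + 2) - moment a b (m - 2)

theorem moment_zero_zero (m : ℤ) : moment 0 0 m = if m = 0 then 1 else 0 := rfl

theorem moment_succ_zero (a : ℕ) (m : ℤ) :
    moment (a + 1) 0 m = 2 * moment a 0 m - moment a 0 (m + 1) - moment a 0 (m - 1) := rfl

theorem moment_succ (a b : ℕ) (m : ℤ) :
    moment a (b + 1) m = 2 * moment a b m - moment a b (m + 2) - moment a b (m - 2) := rfl

theorem moment_neg (a b : ℕ) (m : ℤ) : moment a b (-m) = moment a b m := by
  induction b generalizing m with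
  | zero =>
    induction a generalizing m with
    | zero => simp [moment_zero_zero]
    | succ a ih =>
      simp only [moment_succ_zero, ih]
      rw [← ih (-m + 1), ← ih (-m - 1), show -(-m + 1) = m - 1 by ring,
        show -(-m - 1) = m + 1 by ring]
      ring
  | succ b ih =>
    simp only [moment_succ, ih]
    rw [← ih (-m + 2), ← ih (-m - 2), show -(-m + 2) = m - 2 by ring,
      show -(-m - 2) = m + 2 by ring]
    ring

/-- The three term recurrence of the moments, a form of the Pearson equation of the weight. -/
theorem moment_pearson (a b : ℕ) (m : ℤ) :
    (m + 1 + (a + 2 * b)) * moment a b (m + 1) + 2 * a * moment a b m +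
      ((a + 2 * b) + 1 - m) * moment a b (m - 1) = 0 := by
  induction b generalizing m with
  | zero =>
    induction a generalizing m with
    | zero =>
      simp only [moment_zero_zero]
      by_cases h₁ : m = -1
      · subst h₁; norm_num
      by_cases h₂ : m = 1
      · subst h₂; norm_num
      rw [if_neg (by lia : ¬ m + 1 = 0), if_neg (by lia : ¬ m - 1 = 0)]
      simp
    | succ a ih =>
      have h₀ := ih m
      have h₁ := ih (m + 1)
      have h₂ := ih (m - 1)
      simp only [moment_succ_zero]
      rw [show m + 1 - 1 = m by ring] at *
      rw [show m - 1 + 1 = m by ring] at *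
      push_cast at *
      -- The combination mirrors the factor `2 - z - z⁻¹`; the shifts of `m` inside the coefficients
      -- account exactly for raising `a`.
      linear_combination 2 * h₀ - h₁ - h₂
  | succ b ih =>
    have h₀ := ih m
    have h₁ := ih (m + 2)
    have h₂ := ih (m - 2)
    simp only [moment_succ]
    rw [show m + 2 - 1 = m + 1 by ring, show m + 2 + 1 = m + 1 + 2 by ring] at h₁
    rw [show m - 2 + 1 = m - 1 by ring, show m - 2 - 1 = m - 1 - 2 by ring] at h₂
    rw [show m + 1 - 2 = m - 1 by ring, show m - 1 + 2 = m + 1 by ring]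
    push_cast at *
    linear_combination 2 * h₀ - h₁ - h₂

/-- The Pearson recurrence at `m = 0`, where evenness merges the two outer moments; hence all
moments are multiples of the zeroth. -/
theorem moment_one (a b : ℕ) :
    moment a b 1 = -(a / (a + 2 * b + 1)) * moment a b 0 := by
  have h := moment_pearson a b 0
  have hn := moment_neg a b 1
  norm_num at h hn
  rw [hn] at h
  field_simp
  linear_combination h / 2

theorem moment_two (a b : ℕ) :
    moment a b 2 = (2 * a ^ 2 / (a + 2 * b + 1) - (a + 2 * b)) / (a + 2 * b + 2) *
      moment a b 0 := by
  have h := moment_pearson a b 1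
  norm_num at h
  rw [moment_one] at h
  field_simp at h ⊢
  linear_combination h

theorem Gamma_add_one_of_eq {x y : ℝ} (hy : 0 < y) (h : x = y + 1) :
    Real.Gamma x = y * Real.Gamma y := by
  rw [h, Real.Gamma_add_one hy.ne']

/-- Raising `a` or `b` expresses the new mass through old moments of index at most 1 or 2, hence as
a rational multiple of the old mass. -/
theorem moment_zero_eq (a b : ℕ) :
    moment a b 0 = Real.Gamma (b + 1 / 2) * Real.Gamma (a + b + 1 / 2) *
      Real.Gamma (a + 2 * b + 1) /
        (Real.Gamma (a / 2 + b + 1 / 2) ^ 2 * Real.Gamma (a / 2 + b + 1) ^ 2) := by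
  induction b with
  | zero =>
    induction a with
    | zero =>
      have : Real.Gamma (1 / 2) ≠ 0 := (Real.Gamma_pos_of_pos (by norm_num)).ne'
      simp [moment_zero_zero]
      norm_num at this
      field_simp
    | succ a ih =>
      have h1 : moment a 0 (-1) = moment a 0 1 := moment_neg a 0 1
      have h2 := moment_one a 0
      rw [moment_succ_zero]
      norm_num at h1 h2 ih ⊢
      -- Raising `a` shifts `a / 2` by one half, so the two denominator Gammas trade places and only
      -- one needs the functional equation.
      rw [h1, h2, ih,
        Gamma_add_one_of_eq (x := (a : ℝ) + 1 + 1 / 2) (y := (a : ℝ) + 1 / 2) (by positivity) (by ring),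
        Gamma_add_one_of_eq (x := (a : ℝ) + 1 + 1) (y := (a : ℝ) + 1) (by positivity) (by ring),
        Gamma_add_one_of_eq (x := ((a : ℝ) + 1) / 2 + 1) (y := (a : ℝ) / 2 + 1 / 2)
          (by positivity) (by ring),
        show ((a : ℝ) + 1) / 2 + 1 / 2 = a / 2 + 1 by ring]
      have p1 : Real.Gamma ((a : ℝ) / 2 + 1 / 2) ≠ 0 := (Real.Gamma_pos_of_pos (by positivity)).ne'
      have p2 : Real.Gamma ((a : ℝ) / 2 + 1) ≠ 0 := (Real.Gamma_pos_of_pos (by positivity)).ne'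
      field_simp
      ring
  | succ b ih =>
    have h1 : moment a b (-2) = moment a b 2 := moment_neg a b 2
    have h2 := moment_two a b
    rw [moment_succ, zero_add, zero_sub, h1, h2, ih]
    push_cast
    rw [Gamma_add_one_of_eq (x := (b : ℝ) + 1 + 1 / 2) (y := (b : ℝ) + 1 / 2)
        (by positivity) (by ring),
      Gamma_add_one_of_eq (x := (a : ℝ) + (b + 1) + 1 / 2) (y := (a : ℝ) + b + 1 / 2)
        (by positivity) (by ring),
      Gamma_add_one_of_eq (x := (a : ℝ) + 2 * (b + 1) + 1) (y := (a : ℝ) + 2 * b + 1 + 1)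
        (by positivity) (by ring),
      Gamma_add_one_of_eq (x := (a : ℝ) + 2 * b + 1 + 1) (y := (a : ℝ) + 2 * b + 1)
        (by positivity) (by ring),
      Gamma_add_one_of_eq (x := (a : ℝ) / 2 + (b + 1) + 1 / 2) (y := (a : ℝ) / 2 + b + 1 / 2)
        (by positivity) (by ring),
      Gamma_add_one_of_eq (x := (a : ℝ) / 2 + (b + 1) + 1) (y := (a : ℝ) / 2 + b + 1)
        (by positivity) (by ring)]
    have p1 : Real.Gamma ((a : ℝ) / 2 + b + 1 / 2) ≠ 0 :=
      (Real.Gamma_pos_of_pos (by positivity)).ne'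
    have p2 : Real.Gamma ((a : ℝ) / 2 + b + 1) ≠ 0 := (Real.Gamma_pos_of_pos (by positivity)).ne'
    field_simp
    ring

/-! ### Verblunsky coefficients and the Szegő recursion -/

/-- The numerator of the `N`-th Verblunsky coefficient of the weight `δ_k`. -/
def verblunskyNum (a b N : ℕ) : ℝ := if Even N then a else a + 2 * b

/-- The `N`-th Verblunsky coefficient of the weight `δ_k` (up to sign). -/
def verblunsky (a b N : ℕ) : ℝ := verblunskyNum a b N / (N + 1 + (a + 2 * b))

/-- The moments `L (z⁻ʲ Φ_N)` of the monic orthogonal polynomials `Φ_N` on the unit circle, as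
given by the Szegő recursion. -/
def szegoMoment (a b : ℕ) : ℕ → ℤ → ℝ
  | 0 => moment a b
  | N + 1 => fun j => szegoMoment a b N (j - 1) + verblunsky a b N * szegoMoment a b N (N - j)

theorem szegoMoment_zero (a b : ℕ) (j : ℤ) : szegoMoment a b 0 j = moment a b j := rfl

theorem szegoMoment_succ (a b N : ℕ) (j : ℤ) : szegoMoment a b (N + 1) j =
    szegoMoment a b N (j - 1) + verblunsky a b N * szegoMoment a b N (N - j) := rfl

theorem verblunskyNum_add_two (a b N : ℕ) :
    verblunskyNum a b (N + 2) = verblunskyNum a b N := by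
  simp [verblunskyNum, Nat.even_add]

/-- The differential equation of the polynomials `Φ_N`, in terms of moments. -/
theorem szegoMoment_structure (a b N : ℕ) (j : ℤ) :
    (N + 2 - j + (a + 2 * b)) * szegoMoment a b N (j - 2) + a * szegoMoment a b N (j - 1) +
      (j - N) * szegoMoment a b N j + verblunskyNum a b N * szegoMoment a b N (N + 1 - j) +
      verblunskyNum a b (N + 1) * szegoMoment a b N (N - j) = 0 := by
  induction N generalizing j with
  | zero =>
    have h := moment_pearson a b (j - 1)
    have h₁ := moment_neg a b (j - 1)
    have h₂ := moment_neg a b j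
    simp only [szegoMoment_zero, verblunskyNum]
    rw [show -(j - 1) = 1 - j by ring] at h₁
    rw [show j - 1 - 1 = j - 2 by ring, show j - 1 + 1 = j by ring] at h
    simp [h₁, h₂]
    push_cast at h
    linear_combination h
  | succ N ih =>
    -- The two instances match the two terms of `Φ_{N+1} = z Φ_N + α_N Φ_N^*`, the second one
    -- reflected. The rest cancels because the numerators have period two in `N`.
    have h₁ := ih (j - 1)
    have h₂ := ih (N + 2 - j)
    have hx : verblunskyNum a b N = verblunsky a b N * (N + 1 + (a + 2 * b)) := by
      unfold verblunsky
      field_simp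
    simp only [szegoMoment_succ]
    rw [verblunskyNum_add_two]
    push_cast at *
    rw [show (N : ℤ) + 1 - (j - 1) = N + 2 - j by ring, show (N : ℤ) - (j - 1) = N + 1 - j by ring,
      show j - 1 - 2 = j - 3 by ring, show j - 1 - 1 = j - 2 by ring] at h₁
    rw [show (N : ℤ) + 1 - (N + 2 - j) = j - 1 by ring, show (N : ℤ) - (N + 2 - j) = j - 2 by ring,
      show (N : ℤ) + 2 - j - 2 = N - j by ring, show (N : ℤ) + 2 - j - 1 = N + 1 - j by ring] at h₂
    rw [show j - 2 - 1 = j - 3 by ring, show j - 1 - 1 = j - 2 by ring,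
      show (N : ℤ) - (j - 2) = N + 2 - j by ring, show (N : ℤ) - (j - 1) = N + 1 - j by ring,
      show (N : ℤ) + 1 + 1 - j - 1 = N + 1 - j by ring, show (N : ℤ) + 1 - j - 1 = N - j by ring,
      show (N : ℤ) - (N + 1 + 1 - j) = j - 2 by ring, show (N : ℤ) - (N + 1 - j) = j - 1 by ring]
    rw [hx] at *
    linear_combination h₁ + verblunsky a b N * h₂

/-- This is orthogonality of `Φ_{N+1}` to `1`, so it confirms the choice of `α_N`. Under `h` the
structure relation at `j = 1` collapses to `N+1+a+2b` times the claim. -/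
theorem szegoMoment_neg_one (a b N : ℕ)
    (h : ∀ j : ℤ, 0 ≤ j → j < N → szegoMoment a b N j = 0) :
    szegoMoment a b N (-1) + verblunsky a b N * szegoMoment a b N N = 0 := by
  have hx : verblunskyNum a b N = verblunsky a b N * (N + 1 + (a + 2 * b)) := by
    unfold verblunsky
    field_simp
  have hs := szegoMoment_structure a b N 1
  have hp : (N + 1 + (a + 2 * b) : ℝ) ≠ 0 := by positivity
  rw [hx] at hs
  norm_num at hs
  -- The indices `0, 1, N-1` all lie in `[0, N)` only for `N ≥ 2`. For `N = 0` evenness of the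
  -- moments replaces vanishing; for `N = 1` the coefficient `1 - N` is zero.
  match N with
  | 0 =>
    have h₁ := moment_neg a b 1
    simp [szegoMoment_zero, verblunskyNum, verblunsky] at hs h₁ ⊢
    rw [h₁] at *
    field_simp at *
    linear_combination hs / 2
  | 1 =>
    have h₀ := h 0 (by simp) (by simp)
    norm_num [h₀] at hs hp ⊢
    apply mul_left_cancel₀ hp
    linear_combination hs
  | N + 2 =>
    rw [h 0 (by simp) (by lia), h 1 (by simp) (by lia),
      h (((N + 2 : ℕ) : ℤ) - 1) (by lia) (by lia)] at hs
    apply mul_left_cancel₀ hp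
    push_cast at *
    linear_combination hs

theorem szegoMoment_eq_zero (a b N : ℕ) (j : ℤ) (h₀ : 0 ≤ j) (h₁ : j < N) :
    szegoMoment a b N j = 0 := by
  induction N generalizing j with
  | zero => lia
  | succ N ih =>
    rw [szegoMoment_succ]
    rcases h₀.eq_or_lt with rfl | h
    · simpa using szegoMoment_neg_one a b N ih
    · rw [ih _ (by lia) (by lia), ih _ (by lia) (by lia)]
      simp

/-- Szegő's norm formula: the moment of index `-1` produced by the recursion is `-α_N` times the
diagonal one. -/
theorem szegoMoment_diag_succ (a b N : ℕ) :
    szegoMoment a b (N + 1) (N + 1 : ℕ) =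
      (1 - verblunsky a b N ^ 2) * szegoMoment a b N N := by
  have h := szegoMoment_neg_one a b N (szegoMoment_eq_zero a b N)
  rw [szegoMoment_succ]
  push_cast
  rw [show (N : ℤ) + 1 - 1 = N by ring, show (N : ℤ) - (N + 1) = -1 by ring]
  linear_combination verblunsky a b N * h

theorem szegoMoment_diag_even (a b n : ℕ) :
    szegoMoment a b (2 * n) (2 * n : ℕ) =
      Real.Gamma (n + b + 1 / 2) * Real.Gamma (n + a + b + 1 / 2) * Real.Gamma (n + 1) *
        Real.Gamma (n + a + 2 * b + 1) /
        (Real.Gamma (n + a / 2 + b + 1 / 2) ^ 2 * Real.Gamma (n + a / 2 + b + 1) ^ 2) := by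
  induction n with
  | zero => simp [szegoMoment_zero, moment_zero_eq]
  | succ n ih =>
    rw [show 2 * (n + 1) = 2 * n + 1 + 1 by ring, szegoMoment_diag_succ, szegoMoment_diag_succ, ih]
    have e₁ : ¬ Even (2 * n + 1) := by simp
    have e₂ : Even (2 * n) := by simp
    simp only [verblunsky, verblunskyNum, e₁, e₂, if_true, if_false]
    push_cast
    rw [Gamma_add_one_of_eq (x := (n : ℝ) + 1 + b + 1 / 2) (y := n + b + 1 / 2)
        (by positivity) (by ring),
      Gamma_add_one_of_eq (x := (n : ℝ) + 1 + a + b + 1 / 2) (y := n + a + b + 1 / 2)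
        (by positivity) (by ring),
      Gamma_add_one_of_eq (x := (n : ℝ) + 1 + 1) (y := n + 1) (by positivity) (by ring),
      Gamma_add_one_of_eq (x := (n : ℝ) + 1 + a + 2 * b + 1) (y := n + a + 2 * b + 1)
        (by positivity) (by ring),
      Gamma_add_one_of_eq (x := (n : ℝ) + 1 + a / 2 + b + 1 / 2) (y := n + a / 2 + b + 1 / 2)
        (by positivity) (by ring),
      Gamma_add_one_of_eq (x := (n : ℝ) + 1 + a / 2 + b + 1) (y := n + a / 2 + b + 1)
        (by positivity) (by ring)]
    have p₁ : Real.Gamma ((n : ℝ) + a / 2 + b + 1 / 2) ≠ 0 :=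
      (Real.Gamma_pos_of_pos (by positivity)).ne'
    have p₂ : Real.Gamma ((n : ℝ) + a / 2 + b + 1) ≠ 0 :=
      (Real.Gamma_pos_of_pos (by positivity)).ne'
    field_simp
    ring

theorem szegoMoment_diag_odd (a b n : ℕ) :
    szegoMoment a b (2 * n + 1) (2 * n + 1 : ℕ) =
      Real.Gamma (n + 1 + b + 1 / 2) * Real.Gamma (n + 1 + a + b + 1 / 2) * Real.Gamma (n + 1) *
        Real.Gamma (n + 1 + a + 2 * b) /
        (Real.Gamma (n + 1 + a / 2 + b) ^ 2 * Real.Gamma (n + 1 + a / 2 + b + 1 / 2) ^ 2) := by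
  rw [szegoMoment_diag_succ, szegoMoment_diag_even]
  have e₂ : Even (2 * n) := by simp
  simp only [verblunsky, verblunskyNum, e₂, if_true]
  push_cast
  rw [Gamma_add_one_of_eq (x := (n : ℝ) + 1 + b + 1 / 2) (y := n + b + 1 / 2)
      (by positivity) (by ring),
    Gamma_add_one_of_eq (x := (n : ℝ) + 1 + a + b + 1 / 2) (y := n + a + b + 1 / 2)
      (by positivity) (by ring),
    Gamma_add_one_of_eq (x := (n : ℝ) + 1 + a / 2 + b + 1 / 2) (y := n + a / 2 + b + 1 / 2)
      (by positivity) (by ring),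
    show (n : ℝ) + 1 + a + 2 * b = n + a + 2 * b + 1 by ring,
    show (n : ℝ) + 1 + a / 2 + b = n + a / 2 + b + 1 by ring]
  have p₁ : Real.Gamma ((n : ℝ) + a / 2 + b + 1 / 2) ≠ 0 :=
    (Real.Gamma_pos_of_pos (by positivity)).ne'
  have p₂ : Real.Gamma ((n : ℝ) + a / 2 + b + 1) ≠ 0 :=
    (Real.Gamma_pos_of_pos (by positivity)).ne'
  field_simp
  ring

/-- The explicit Gamma values stand in for positive definiteness of the pairing and make the
Gram–Schmidt quotients meaningful. -/
theorem szegoMoment_diag_ne_zero (a b N : ℕ) : szegoMoment a b N N ≠ 0 := by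
  have h (x : ℝ) (hx : 0 < x) := (Real.Gamma_pos_of_pos hx).ne'
  obtain ⟨n, rfl | rfl⟩ := N.even_or_odd'
  · rw [szegoMoment_diag_even]
    have := h (n + b + 1 / 2) (by positivity)
    have := h (n + a + b + 1 / 2) (by positivity)
    have := h (n + 1) (by positivity)
    have := h (n + a + 2 * b + 1) (by positivity)
    have := h (n + a / 2 + b + 1 / 2) (by positivity)
    have := h (n + a / 2 + b + 1) (by positivity)
    positivity
  · rw [szegoMoment_diag_odd]
    have := h (n + 1 + b + 1 / 2) (by positivity)
    have := h (n + 1 + a + b + 1 / 2) (by positivity)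
    have := h (n + 1) (by positivity)
    have := h (n + 1 + a + 2 * b) (by positivity)
    have := h (n + 1 + a / 2 + b) (by positivity)
    have := h (n + 1 + a / 2 + b + 1 / 2) (by positivity)
    positivity

/-! ### The pairing as a contour integral -/

open LaurentPolynomial

theorem weight_eq_of_norm_eq_one (a b : ℕ) {z : ℂ} (hz : ‖z‖ = 1) :
    (weight ⟨a, b⟩ z : ℂ) = (2 - (z + z⁻¹)) ^ a * (2 - (z ^ 2 + (z ^ 2)⁻¹)) ^ b := by
  have key (w : ℂ) (hw : ‖w‖ = 1) : ((2 - (w + w⁻¹)).re : ℂ) = 2 - (w + w⁻¹) := by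
    rw [← Complex.conj_eq_iff_re]
    have h : starRingEnd ℂ w = w⁻¹ := by
      rw [Complex.inv_def, Complex.normSq_eq_norm_sq, hw]
      simp
    rw [map_sub, map_add, map_inv₀, h, inv_inv, add_comm, map_ofNat]
  simp only [weight, Real.rpow_natCast]
  push_cast
  rw [key z hz, key (z ^ 2) (by simp [hz])]

/-- On the unit circle, the complex weight function with natural number multiplicities. -/
def circleWeight (a b : ℕ) (z : ℂ) : ℂ := (2 - (z + z⁻¹)) ^ a * (2 - (z ^ 2 + (z ^ 2)⁻¹)) ^ b

theorem ne_zero_of_mem_unitSphere {z : ℂ} (hz : z ∈ Metric.sphere (0 : ℂ) 1) : z ≠ 0 := by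
  rintro rfl
  simp at hz

theorem circleIntegrable_zpow_mul_circleWeight (a b : ℕ) (m : ℤ) :
    CircleIntegrable (fun z => z ^ m * circleWeight a b z / z) 0 1 := by
  refine ContinuousOn.circleIntegrable zero_le_one fun z hz => ContinuousAt.continuousWithinAt ?_
  have h := ne_zero_of_mem_unitSphere hz
  unfold circleWeight
  fun_prop (disch := simp [h])

theorem circleIntegral_zpow_mul_circleWeight (a b : ℕ) (m : ℤ) :
    (2 * (Real.pi : ℂ) * Complex.I)⁻¹ * ∮ z in C(0, 1), z ^ m * circleWeight a b z / z =
      (moment a b m : ℂ) := by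
  -- Multiplying the weight by `2 - z^s - z^(-s)` reproduces the recursion defining `moment`: `s =
  -- 1` raises `a`, `s = 2` raises `b`.
  have expand (a b a' b' : ℕ) (s : ℤ) (m : ℤ)
      (h : ∀ z : ℂ, z ≠ 0 →
        circleWeight a' b' z = (2 - (z ^ s + z ^ (-s))) * circleWeight a b z) :
      (∮ z in C(0, 1), z ^ m * circleWeight a' b' z / z) =
        2 * (∮ z in C(0, 1), z ^ m * circleWeight a b z / z) -
          (∮ z in C(0, 1), z ^ (m + s) * circleWeight a b z / z) -
          (∮ z in C(0, 1), z ^ (m - s) * circleWeight a b z / z) := by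
    have i := circleIntegrable_zpow_mul_circleWeight a b
    have i₂ : CircleIntegrable (fun z => 2 * (z ^ m * circleWeight a b z / z)) 0 1 :=
      (i m).const_smul (a := (2 : ℂ))
    rw [← circleIntegral.integral_const_mul, ← circleIntegral.integral_sub i₂ (i _),
      ← circleIntegral.integral_sub (show CircleIntegrable (fun z =>
        2 * (z ^ m * circleWeight a b z / z) - z ^ (m + s) * circleWeight a b z / z) 0 1 from
          i₂.sub (i _)) (i _)]
    refine circleIntegral.integral_congr zero_le_one fun z hz => ?_
    have hz₀ := ne_zero_of_mem_unitSphere hz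
    simp only [h z hz₀, zpow_add₀ hz₀, zpow_sub₀ hz₀, zpow_neg]
    ring
  induction b generalizing m with
  | zero =>
    induction a generalizing m with
    | zero =>
      rw [moment_zero_zero]
      have e : (∮ z in C(0, 1), z ^ m * circleWeight 0 0 z / z) =
          ∮ z in C(0, 1), (z - 0) ^ (m - 1) := by
        refine circleIntegral.integral_congr zero_le_one fun z hz => ?_
        have hz₀ := ne_zero_of_mem_unitSphere hz
        simp [circleWeight, zpow_sub₀ hz₀]
      rw [e]
      split_ifs with h
      · subst h
        have hpi : (Real.pi : ℂ) ≠ 0 := by exact_mod_cast Real.pi_ne_zero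
        have := circleIntegral.integral_sub_center_inv (0 : ℂ) (R := 1) one_ne_zero
        simp only [zero_sub, zpow_neg_one, this]
        simp only [Complex.ofReal_one]
        exact inv_mul_cancel₀ (by simp [hpi])
      · rw [circleIntegral.integral_sub_zpow_of_ne (by lia)]
        simp
    | succ a ih =>
      rw [expand a 0 (a + 1) 0 1 m fun z _ => by simp [circleWeight]; ring, moment_succ_zero]
      push_cast
      simp only [← ih]
      ring
  | succ b ih =>
    rw [expand a b a (b + 1) 2 m fun z _ => by
      simp only [circleWeight, zpow_neg, zpow_ofNat]; ring, moment_succ]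
    push_cast
    simp only [← ih]
    ring

theorem evalAt_add (f g : ℂ[T;T⁻¹]) (z : ℂ) : evalAt (f + g) z = evalAt f z + evalAt g z := by
  unfold evalAt
  rw [AddMonoidAlgebra.coeff_add, Finsupp.sum_add_index' (by simp) (by simp [add_mul])]

theorem evalAt_smul (c : ℂ) (f : ℂ[T;T⁻¹]) (z : ℂ) : evalAt (c • f) z = c * evalAt f z := by
  unfold evalAt
  rw [AddMonoidAlgebra.coeff_smul, Finsupp.sum_smul_index' (by simp), Finsupp.mul_sum]
  simp [mul_assoc]

theorem evalAt_T (n : ℤ) (z : ℂ) : evalAt (T n) z = z ^ n := by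
  simp [evalAt, T, -single_eq_C_mul_T]

theorem continuousOn_evalAt (f : ℂ[T;T⁻¹]) :
    ContinuousOn (evalAt f) (Metric.sphere (0 : ℂ) 1) := by
  unfold evalAt Finsupp.sum
  refine continuousOn_finsetSum _ fun n _ z hz => ContinuousAt.continuousWithinAt ?_
  have h := ne_zero_of_mem_unitSphere hz
  fun_prop (disch := simp [h])

theorem continuousOn_circleWeight (a b : ℕ) :
    ContinuousOn (circleWeight a b) (Metric.sphere (0 : ℂ) 1) := by
  intro z hz
  have h := ne_zero_of_mem_unitSphere hz
  unfold circleWeight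
  refine ContinuousAt.continuousWithinAt ?_
  fun_prop (disch := simp [h])

theorem pairing_eq (a b : ℕ) (f g : ℂ[T;T⁻¹]) :
    pairing ⟨a, b⟩ f g = (2 * (Real.pi : ℂ) * Complex.I)⁻¹ *
      ∮ z in C(0, 1), (starRingEnd ℂ (evalAt f z) * evalAt g z * circleWeight a b z) / z := by
  unfold pairing
  congr 1
  refine circleIntegral.integral_congr zero_le_one fun z hz => ?_
  simp only [weight_eq_of_norm_eq_one a b (by simpa using hz), circleWeight]

theorem circleIntegrable_pairing (a b : ℕ) (f g : ℂ[T;T⁻¹]) :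
    CircleIntegrable
      (fun z => (starRingEnd ℂ (evalAt f z) * evalAt g z * circleWeight a b z) / z) 0 1 := by
  refine ContinuousOn.circleIntegrable zero_le_one ?_
  exact (((Complex.continuous_conj.comp_continuousOn (continuousOn_evalAt f)).mul
    (continuousOn_evalAt g)).mul (continuousOn_circleWeight a b)).div continuousOn_id
    fun z hz => ne_zero_of_mem_unitSphere hz

theorem pairing_add_right (a b : ℕ) (f g h : ℂ[T;T⁻¹]) :
    pairing ⟨a, b⟩ f (g + h) = pairing ⟨a, b⟩ f g + pairing ⟨a, b⟩ f h := by
  simp only [pairing_eq]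
  rw [← mul_add, ← circleIntegral.integral_add (circleIntegrable_pairing a b f g)
    (circleIntegrable_pairing a b f h)]
  congr 1
  refine circleIntegral.integral_congr zero_le_one fun z _ => ?_
  simp only [evalAt_add]
  ring

theorem pairing_smul_right (a b : ℕ) (c : ℂ) (f g : ℂ[T;T⁻¹]) :
    pairing ⟨a, b⟩ f (c • g) = c * pairing ⟨a, b⟩ f g := by
  rw [pairing_eq, pairing_eq, mul_left_comm c, ← circleIntegral.integral_const_mul c]
  congr 1
  refine circleIntegral.integral_congr zero_le_one fun z _ => ?_
  simp only [evalAt_smul]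
  ring

theorem pairing_add_left (a b : ℕ) (f g h : ℂ[T;T⁻¹]) :
    pairing ⟨a, b⟩ (f + g) h = pairing ⟨a, b⟩ f h + pairing ⟨a, b⟩ g h := by
  simp only [pairing_eq]
  rw [← mul_add, ← circleIntegral.integral_add (circleIntegrable_pairing a b f h)
    (circleIntegrable_pairing a b g h)]
  congr 1
  refine circleIntegral.integral_congr zero_le_one fun z _ => ?_
  simp only [evalAt_add, map_add]
  ring

theorem pairing_smul_left (a b : ℕ) (c : ℂ) (f g : ℂ[T;T⁻¹]) :
    pairing ⟨a, b⟩ (c • f) g = starRingEnd ℂ c * pairing ⟨a, b⟩ f g := by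
  rw [pairing_eq, pairing_eq, mul_left_comm (starRingEnd ℂ c),
    ← circleIntegral.integral_const_mul (starRingEnd ℂ c)]
  congr 1
  refine circleIntegral.integral_congr zero_le_one fun z _ => ?_
  simp only [evalAt_smul, map_mul]
  ring

theorem pairing_T_T (a b : ℕ) (i j : ℤ) :
    pairing ⟨a, b⟩ (T i) (T j) = (moment a b (j - i) : ℂ) := by
  rw [pairing_eq, ← circleIntegral_zpow_mul_circleWeight]
  congr 1
  refine circleIntegral.integral_congr zero_le_one fun z hz => ?_
  have hz₀ := ne_zero_of_mem_unitSphere hz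
  have h : starRingEnd ℂ z = z⁻¹ := by
    rw [Complex.inv_def, Complex.normSq_eq_norm_sq, show ‖z‖ = 1 by simpa using hz]
    simp
  simp only [evalAt_T, map_zpow₀, h, zpow_sub₀ hz₀, inv_zpow]
  ring

theorem pairing_conj_symm (a b : ℕ) (f g : ℂ[T;T⁻¹]) :
    starRingEnd ℂ (pairing ⟨a, b⟩ f g) = pairing ⟨a, b⟩ g f := by
  induction f using LaurentPolynomial.induction_on' with
  | add p q hp hq => rw [pairing_add_left, pairing_add_right, map_add, hp, hq]
  | C_mul_T n c =>
    induction g using LaurentPolynomial.induction_on' with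
    | add p q hp hq => rw [pairing_add_left, pairing_add_right, map_add, hp, hq]
    | C_mul_T m d =>
      simp only [← smul_eq_C_mul, pairing_smul_left, pairing_smul_right, pairing_T_T, map_mul,
        Complex.conj_ofReal, Complex.conj_conj]
      rw [← moment_neg, neg_sub]
      ring

/-- The pairing `(f, ·)_k` as a linear functional. -/
def pairingLinear (a b : ℕ) (f : ℂ[T;T⁻¹]) : ℂ[T;T⁻¹] →ₗ[ℂ] ℂ where
  toFun := pairing ⟨a, b⟩ f
  map_add' := pairing_add_right a b f
  map_smul' c := pairing_smul_right a b c f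

theorem pairingLinear_apply (a b : ℕ) (f g : ℂ[T;T⁻¹]) :
    pairingLinear a b f g = pairing ⟨a, b⟩ f g := rfl

/-- Invariance of the weight under `z ↦ z⁻¹`, in the form of evenness of the moments. -/
theorem pairing_T_mul_invert (a b : ℕ) (e i : ℤ) (f : ℂ[T;T⁻¹]) :
    pairing ⟨a, b⟩ (T i) (T e * invert f) = pairing ⟨a, b⟩ (T (e - i)) f := by
  induction f using LaurentPolynomial.induction_on' with
  | add p q hp hq => rw [map_add, mul_add, pairing_add_right, pairing_add_right, hp, hq]
  | C_mul_T n c =>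
    rw [← smul_eq_C_mul, map_smul, mul_smul_comm, pairing_smul_right, pairing_smul_right,
      invert_T, ← T_add, pairing_T_T, pairing_T_T, ← moment_neg]
    congr 3
    ring

/-! ### Orthogonal Laurent polynomials from the Szegő recursion -/

/-- The exponent `e` for which `z ↦ z⁻¹`, followed by multiplication by `zᵉ`, preserves the span
of the first `j` monomials. -/
def shiftExponent (j : ℕ) : ℤ := if Even j then 1 else 0

/-- The non-symmetric Jacobi polynomials, given by the Szegő recursion. -/
def szegoJacobi (a b : ℕ) : ℕ → ℂ[T;T⁻¹]
  | 0 => 1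
  | j + 1 => T (shiftExponent j) * invert (szegoJacobi a b j) +
      (verblunsky a b j : ℂ) • szegoJacobi a b j

theorem szegoJacobi_succ (a b j : ℕ) : szegoJacobi a b (j + 1) =
    T (shiftExponent j) * invert (szegoJacobi a b j) +
      (verblunsky a b j : ℂ) • szegoJacobi a b j := rfl

/-- The index of the moment of `Φ_j` that is the pairing of `zⁱ` with the `j`-th non-symmetric
Jacobi polynomial. -/
def momentIndex (j : ℕ) (i : ℤ) : ℤ := if Even j then (j / 2 : ℕ) - i else i + (j / 2 : ℕ)

/-- `szegoJacobi a b j` plays the role of `z^(-(j-1)/2) Φ_j(z)` for odd `j` and of `z^(j/2)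
Φ_j(z⁻¹)` for even `j`; `momentIndex` records this substitution. -/
theorem pairing_T_szegoJacobi (a b j : ℕ) (i : ℤ) :
    pairing ⟨a, b⟩ (T i) (szegoJacobi a b j) = (szegoMoment a b j (momentIndex j i) : ℂ) := by
  induction j generalizing i with
  | zero =>
    rw [szegoJacobi, ← T_zero, pairing_T_T]
    simp [momentIndex, szegoMoment_zero]
  | succ j ih =>
    have h₁ : momentIndex j (shiftExponent j - i) = momentIndex (j + 1) i - 1 := by
      unfold momentIndex shiftExponent
      simp only [Nat.even_iff]
      split_ifs <;> lia
    have h₂ : momentIndex j i = j - momentIndex (j + 1) i := by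
      unfold momentIndex
      simp only [Nat.even_iff]
      split_ifs <;> lia
    rw [szegoJacobi_succ, pairing_add_right, pairing_smul_right, pairing_T_mul_invert, ih, ih,
      szegoMoment_succ, h₁, h₂]
    push_cast
    ring

/-- The span of the first `j` monomials in the ordered basis `1, z, z⁻¹, z², z⁻², …`. -/
def lowerSpan (j : ℕ) : Submodule ℂ ℂ[T;T⁻¹] :=
  Submodule.span ℂ ((fun i => T (exponent i)) '' Set.Iio j)

theorem T_mem_lowerSpan {i j : ℕ} (h : i < j) : (T (exponent i) : ℂ[T;T⁻¹]) ∈ lowerSpan j :=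
  Submodule.subset_span ⟨i, h, rfl⟩

theorem lowerSpan_mono {i j : ℕ} (h : i ≤ j) : lowerSpan i ≤ lowerSpan j :=
  Submodule.span_mono (Set.image_mono (Set.Iio_subset_Iio h))

/-- The first `j` exponents form an interval of integers symmetric under `i ↦ shiftExponent j - i`.
-/
theorem T_mul_invert_mem_lowerSpan (j : ℕ) {f : ℂ[T;T⁻¹]} (hf : f ∈ lowerSpan j) :
    T (shiftExponent j) * invert f ∈ lowerSpan j := by
  induction hf using Submodule.span_induction with
  | mem f hf =>
    obtain ⟨i, hi, rfl⟩ := hf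
    have hi : i < j := hi
    rw [invert_T, ← T_add, ← exponent_position (shiftExponent j + -exponent i)]
    refine T_mem_lowerSpan ?_
    unfold position shiftExponent exponent
    simp only [Nat.even_iff]
    split_ifs <;> lia
  | zero => simp
  | add f g _ _ hf hg =>
    rw [map_add, mul_add]
    exact add_mem hf hg
  | smul c f _ hf =>
    rw [map_smul, mul_smul_comm]
    exact Submodule.smul_mem _ c hf

theorem szegoJacobi_sub_T_mem_lowerSpan (a b j : ℕ) :
    szegoJacobi a b j - T (exponent j) ∈ lowerSpan j := by
  induction j with
  | zero => simp [szegoJacobi, exponent]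
  | succ j ih =>
    have h₁ := lowerSpan_mono j.le_succ (T_mul_invert_mem_lowerSpan j ih)
    have h₂ := (lowerSpan (j + 1)).add_mem (lowerSpan_mono j.le_succ ih)
      (T_mem_lowerSpan j.lt_succ_self)
    rw [sub_add_cancel] at h₂
    have h₃ := (lowerSpan (j + 1)).smul_mem (verblunsky a b j : ℂ) h₂
    -- The same reflection carries the old leading exponent to the next one, with coefficient 1; the
    -- Verblunsky term only adds lower monomials.
    have e : shiftExponent j + -exponent j = exponent (j + 1) := by
      unfold shiftExponent exponent
      simp only [Nat.even_iff]
      split_ifs <;> lia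
    rw [map_sub, mul_sub, invert_T, ← T_add, e] at h₁
    convert add_mem h₁ h₃ using 1
    rw [szegoJacobi_succ]
    abel

theorem szegoJacobi_mem_lowerSpan (a b : ℕ) {i j : ℕ} (h : i < j) :
    szegoJacobi a b i ∈ lowerSpan j := by
  have := add_mem (lowerSpan_mono h.le (szegoJacobi_sub_T_mem_lowerSpan a b i)) (T_mem_lowerSpan h)
  rwa [sub_add_cancel] at this

theorem pairing_szegoJacobi_of_mem_lowerSpan (a b j : ℕ) {f : ℂ[T;T⁻¹]} (hf : f ∈ lowerSpan j) :
    pairing ⟨a, b⟩ (szegoJacobi a b j) f = 0 := by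
  induction hf using Submodule.span_induction with
  | mem f hf =>
    obtain ⟨i, hi, rfl⟩ := hf
    have hi : i < j := hi
    -- For `i < j` the index `momentIndex j (exponent i)` falls in `[0, j)`, exactly the vanishing
    -- range.
    rw [← pairing_conj_symm, pairing_T_szegoJacobi, szegoMoment_eq_zero]
    · simp
    all_goals
      unfold momentIndex exponent
      simp only [Nat.even_iff]
      split_ifs <;> lia
  | zero => exact (pairingLinear a b _).map_zero
  | add f g _ _ hf hg => rw [pairing_add_right, hf, hg, add_zero]
  | smul c f _ hf => rw [pairing_smul_right, hf, mul_zero]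

theorem pairing_szegoJacobi_T (a b j : ℕ) :
    pairing ⟨a, b⟩ (szegoJacobi a b j) (T (exponent j)) = (szegoMoment a b j j : ℂ) := by
  have h : momentIndex j (exponent j) = j := by
    unfold momentIndex exponent
    simp only [Nat.even_iff]
    split_ifs <;> lia
  rw [← pairing_conj_symm, pairing_T_szegoJacobi, h, Complex.conj_ofReal]

theorem pairing_szegoJacobi_self (a b j : ℕ) :
    pairing ⟨a, b⟩ (szegoJacobi a b j) (szegoJacobi a b j) = (szegoMoment a b j j : ℂ) := by
  have h := pairing_szegoJacobi_of_mem_lowerSpan a b j (szegoJacobi_sub_T_mem_lowerSpan a b j)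
  rw [← pairingLinear_apply, map_sub, pairingLinear_apply, pairingLinear_apply,
    pairing_szegoJacobi_T] at h
  exact sub_eq_zero.mp h

theorem pairing_szegoJacobi_of_ne (a b : ℕ) {i j : ℕ} (h : i ≠ j) :
    pairing ⟨a, b⟩ (szegoJacobi a b i) (szegoJacobi a b j) = 0 := by
  rcases h.lt_or_gt with h | h
  · rw [← pairing_conj_symm, pairing_szegoJacobi_of_mem_lowerSpan a b j
      (szegoJacobi_mem_lowerSpan a b h), map_zero]
  · exact pairing_szegoJacobi_of_mem_lowerSpan a b i (szegoJacobi_mem_lowerSpan a b h)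

theorem pairing_szegoJacobi_self_ne_zero (a b j : ℕ) :
    pairing ⟨a, b⟩ (szegoJacobi a b j) (szegoJacobi a b j) ≠ 0 := by
  rw [pairing_szegoJacobi_self]
  exact_mod_cast szegoMoment_diag_ne_zero a b j

theorem eq_sum_of_mem_lowerSpan (a b j : ℕ) {f : ℂ[T;T⁻¹]} (hf : f ∈ lowerSpan j) :
    f = ∑ i ∈ Finset.range j, (pairing ⟨a, b⟩ (szegoJacobi a b i) f /
      pairing ⟨a, b⟩ (szegoJacobi a b i) (szegoJacobi a b i)) • szegoJacobi a b i := by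
  induction j generalizing f with
  | zero => simpa [lowerSpan] using hf
  | succ j ih =>
    have hIio : Set.Iio (j + 1) = insert j (Set.Iio j) := by ext; simp
    rw [lowerSpan, hIio, Set.image_insert_eq, Submodule.mem_span_insert] at hf
    obtain ⟨c, g, hg, rfl⟩ := hf
    have hg' : g - c • (szegoJacobi a b j - T (exponent j)) ∈ lowerSpan j :=
      sub_mem hg (Submodule.smul_mem _ c (szegoJacobi_sub_T_mem_lowerSpan a b j))
    generalize hr : g - c • (szegoJacobi a b j - T (exponent j)) = r at hg'
    have e : c • T (exponent j) + g = c • szegoJacobi a b j + r := by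
      rw [← hr, smul_sub]
      abel
    rw [e, Finset.sum_range_succ, pairing_add_right, pairing_smul_right,
      pairing_szegoJacobi_of_mem_lowerSpan a b j hg', add_zero,
      mul_div_cancel_right₀ _ (pairing_szegoJacobi_self_ne_zero a b j), add_comm]
    congr 1
    conv_lhs => rw [ih hg']
    refine Finset.sum_congr rfl fun i hi => ?_
    rw [pairing_add_right, pairing_smul_right,
      pairing_szegoJacobi_of_ne a b (Finset.mem_range.mp hi).ne, mul_zero, add_zero]

/-- In the orthogonal expansion of the `j`-th monomial the coefficient of `szegoJacobi a b j` is 1;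
solving for that term gives the Gram–Schmidt recursion. -/
theorem gramSchmidtSeq_eq_szegoJacobi (a b j : ℕ) :
    gramSchmidtSeq ⟨a, b⟩ j = szegoJacobi a b j := by
  induction j using Nat.strong_induction_on with
  | _ j ih =>
    rw [gramSchmidtSeq, Finset.sum_congr rfl fun (i : Fin j) _ => by rw [ih i i.2],
      Fin.sum_univ_eq_sum_range (fun i => (pairing ⟨a, b⟩ (szegoJacobi a b i) (T (exponent j)) /
        pairing ⟨a, b⟩ (szegoJacobi a b i) (szegoJacobi a b i)) • szegoJacobi a b i) j]
    have h := eq_sum_of_mem_lowerSpan a b (j + 1) (T_mem_lowerSpan j.lt_succ_self)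
    rw [Finset.sum_range_succ, pairing_szegoJacobi_T, ← pairing_szegoJacobi_self,
      div_self (pairing_szegoJacobi_self_ne_zero a b j), one_smul] at h
    rw [sub_eq_iff_eq_add, add_comm]
    exact h

theorem normSq_E (a b : ℕ) (n : ℤ) :
    normSq ⟨a, b⟩ (E n ⟨a, b⟩) = (szegoMoment a b (position n) (position n) : ℂ) := by
  rw [normSq, E, gramSchmidtSeq_eq_szegoJacobi, pairing_szegoJacobi_self]

/-! ### Norms as quotients of `c`-functions -/

theorem szegoMoment_diag_odd_eq (a b n : ℕ) :
    szegoMoment a b (2 * n + 1) (2 * n + 1 : ℕ) =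
      cStar 1 (-((n + 1 : ℝ) + rho ⟨a, b⟩)) ⟨a, b⟩ / cTilde 1 ((n + 1 : ℝ) + rho ⟨a, b⟩) ⟨a, b⟩ := by
  have h (x : ℝ) (hx : 0 < x) := (Real.Gamma_pos_of_pos hx).ne'
  have h₁ := h (n + 1 + a / 2 + b) (by positivity)
  have h₂ := h (n + 1 + a / 2 + b + 1 / 2) (by positivity)
  rw [szegoMoment_diag_odd]
  simp only [cStar, cTilde, rho, if_true, Real.rpow_natCast]
  rw [show -(-((n : ℝ) + 1 + (a + 2 * b) / 2)) - a / 2 + 1 / 2 = n + 1 + b + 1 / 2 by ring,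
    show -(-((n : ℝ) + 1 + (a + 2 * b) / 2)) - a / 2 - b = n + 1 by ring,
    show -(-((n : ℝ) + 1 + (a + 2 * b) / 2)) = n + 1 + a / 2 + b by ring,
    show (n : ℝ) + 1 + (a + 2 * b) / 2 = n + 1 + a / 2 + b by ring,
    show (n : ℝ) + 1 + a / 2 + b + a / 2 + 1 / 2 = n + 1 + a + b + 1 / 2 by ring,
    show (n : ℝ) + 1 + a / 2 + b + a / 2 + b = n + 1 + a + 2 * b by ring]
  field_simp

theorem szegoMoment_diag_even_eq (a b n : ℕ) :
    szegoMoment a b (2 * n) (2 * n : ℕ) =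
      cStar (-1) (-((n : ℝ) + rho ⟨a, b⟩)) ⟨a, b⟩ / cTilde (-1) ((n : ℝ) + rho ⟨a, b⟩) ⟨a, b⟩ := by
  have h (x : ℝ) (hx : 0 < x) := (Real.Gamma_pos_of_pos hx).ne'
  have h₁ := h (n + a / 2 + b + 1 / 2) (by positivity)
  have h₂ := h (n + a / 2 + b + 1) (by positivity)
  have hu : ¬ (-1 : ℤˣ) = 1 := by decide
  rw [szegoMoment_diag_even]
  simp only [cStar, cTilde, rho, if_neg hu, Real.rpow_natCast]
  rw [show -(-((n : ℝ) + (a + 2 * b) / 2)) - a / 2 + 1 / 2 = n + b + 1 / 2 by ring,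
    show -(-((n : ℝ) + (a + 2 * b) / 2)) - a / 2 - b + 1 = n + 1 by ring,
    show -(-((n : ℝ) + (a + 2 * b) / 2)) = n + a / 2 + b by ring,
    show (n : ℝ) + (a + 2 * b) / 2 = n + a / 2 + b by ring,
    show (n : ℝ) + a / 2 + b + a / 2 + 1 / 2 = n + a + b + 1 / 2 by ring,
    show (n : ℝ) + a / 2 + b + a / 2 + b + 1 = n + a + 2 * b + 1 by ring]
  field_simp

end NonsymJacobi

end

theorem mainTheorem9 (k₁ k₂ : ℤ) (hk₁_even : Even k₁) (hk₁ : 1 ≤ k₁) (hk₂ : 1 ≤ k₂)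
    (k : NonsymJacobi.Multiplicity) (hk : k = ⟨(k₁ : ℝ), (k₂ : ℝ)⟩)
    (n : ℤ) (w : ℤˣ)
    (hw : w = NonsymJacobi.shortest n * NonsymJacobi.longestStab (NonsymJacobi.dominant n)) :
    NonsymJacobi.normSq k (NonsymJacobi.E n k) =
      ((NonsymJacobi.cStar w (-((NonsymJacobi.dominant n : ℝ) + NonsymJacobi.rho k)) k /
        NonsymJacobi.cTilde w ((NonsymJacobi.dominant n : ℝ) + NonsymJacobi.rho k) k : ℝ) : ℂ) := by
  subst hk hw
  lift k₁ to ℕ using by lia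
  lift k₂ to ℕ using by lia
  simp only [Int.cast_natCast]
  rw [NonsymJacobi.normSq_E]
  congr 1
  -- Positive weights sit at odd positions and have `w = 1`. The others sit at even positions and
  -- have `w = s`; zero belongs here because its stabilizer contributes `s`.
  by_cases hn : 0 < n
  · obtain ⟨m, rfl⟩ : ∃ m : ℕ, n = m + 1 := ⟨(n - 1).toNat, by lia⟩
    have h₁ : NonsymJacobi.position (m + 1) = 2 * m + 1 := by
      unfold NonsymJacobi.position
      split_ifs
      lia
    have h₂ : NonsymJacobi.dominant (m + 1) = m + 1 := abs_of_pos hn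
    rw [h₁, h₂, NonsymJacobi.szegoMoment_diag_odd_eq, NonsymJacobi.shortest, if_pos hn.le,
      NonsymJacobi.longestStab, if_neg hn.ne', mul_one]
    push_cast
    rfl
  · obtain ⟨m, rfl⟩ : ∃ m : ℕ, n = -m := ⟨(-n).toNat, by lia⟩
    have h₁ : NonsymJacobi.position (-m) = 2 * m := by
      unfold NonsymJacobi.position
      split_ifs
      lia
    have h₂ : NonsymJacobi.dominant (-m) = m := by simp [NonsymJacobi.dominant]
    have h₃ : NonsymJacobi.shortest (-m) * NonsymJacobi.longestStab m = -1 := by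
      unfold NonsymJacobi.shortest NonsymJacobi.longestStab
      split_ifs <;> first | rfl | lia
    rw [h₁, h₂, h₃, NonsymJacobi.szegoMoment_diag_even_eq]
    push_cast
    rfl
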